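/- Conventions. $Ga(\alpha,s)$ is the Gamma distribution with shape $\alpha$ and scale $s$, and $NB(\alpha,q)$ is the negative binomial distribution with size $\alpha>0$ and success probability $q$, i.e. mass $\frac{\Gamma(y+\alpha)}{\Gamma(\alpha)\,y!}(1-q)^y q^\alpha$ at $y=0,1,2,\dots$. Two-group model. Fix $\alpha,\delta>0$. For each $n$ let $p=p_n\in(0,1)$ and $\beta=\beta_n>0$ with $p_n\to0$ and $\beta_n/p_n^{C_1}\to c$ for some constants $C_1>1$ and $c\in(0,\infty)$ (in particular this holds if $\beta_n=c\,p_n^{C_1}$). The triples $(\nu_i,\theta_i,Y_i)$, $i=1,\dots,n$, are independent with $P(\nu_i=1)=p=1-P(\nu_i=0)$, $\theta_i\mid\nu_i=0\sim Ga(\alpha,\beta)$, $\theta_i\mid\nu_i=1\sim Ga(\alpha,\beta+\delta)$ and $Y_i\mid\theta_i\sim \mathrm{Poi}(\theta_i)$. We test $H_{0i}:\nu_i=0$ against $H_{1i}:\nu_i=1$ simultaneously for all $i$; the Bayes risk of a multiple testing rule is the expected number of indices $i$ for which the decision on $H_{0i}$ is wrong (additive $0$-$1$ loss). Bayes oracle.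 Let $R^{\mathrm{BO}}_{\mathrm{Opt}}$ be the Bayes risk of the Bayes oracle, the rule that rejects $H_{0i}$ if $$Y_i>\frac{\log\frac{1-p}{p}+\alpha\log\frac{\beta+\delta+1}{\beta+1}}{\log\frac{(\beta+\delta)(\beta+1)}{\beta(\beta+\delta+1)}}.$$ One-group rule. Let $a>1$, $K>0$, and let $L:(0,\infty)\to(0,\infty)$ be measurable, non-constant and slowly varying at infinity ($L(xt)/L(t)\to1$ as $t\to\infty$ for every $x>0$) such that $\pi_1(t)=Kt^{-a-1}L(t)$ is a probability density on $(0,\infty)$. Suppose that (A1) there are $c_0,t_0>0$ with $L(t)\ge c_0$ for all $t\ge t_0$, and $\lim_{t\to\infty}L(t)$ exists in $(0,\infty)$; (A2) $\sup_{t>0}L(t)\le M$ for some $M<\infty$. For $\tau>0$ consider the one-group model $\lambda^2\sim\pi_1$, $\theta\mid\lambda^2\sim Ga(\alpha,\lambda^2\tau^2)$, $Y\mid\theta\sim\mathrm{Poi}(\theta)$, put $\kappa=1/(1+\lambda^2\tau^2)$, and let $E(\kappa\mid y,\tau)$ be the posterior mean of $\kappa$ given $Y=y$ in this model. Let $\tau=\tau_n>0$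 with $\tau_n\to0$, and let $R_{\mathrm{OG}}$ be the Bayes risk, in the two-group model, of the rule that rejects $H_{0i}$ if $$1-E(\kappa\mid Y_i,\tau)>\frac{\delta}{2(\delta+1)}.$$ Theorem. As $n\to\infty$, $$1\le\liminf_{n\to\infty}\frac{R_{\mathrm{OG}}}{R^{\mathrm{BO}}_{\mathrm{Opt}}}\le\limsup_{n\to\infty}\frac{R_{\mathrm{OG}}}{R^{\mathrm{BO}}_{\mathrm{Opt}}}\le(\delta+1)^\alpha\,P\Big(Y\le 2a+\alpha-\frac{2(a+\alpha)}{\delta+2}\Big),\qquad Y\sim NB\Big(\alpha,\frac1{\delta+1}\Big),$$ and $R^{\mathrm{BO}}_{\mathrm{Opt}}=np(\delta+1)^{-\alpha}(1+o(1))$. -/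

import Mathlib

open MeasureTheory ProbabilityTheory Filter Topology Set
open scoped ENNReal NNReal

noncomputable section

/-- `Ga(α, s)`: the Gamma distribution with shape `α` and scale `s`
(Mathlib's `gammaMeasure` is parametrised by the rate `1 / s`). -/
def gammaScale (α s : ℝ) : Measure ℝ := gammaMeasure α (1 / s)

/-- `Poi(θ)` for a real mean `θ ≥ 0`. -/
def poissonMean (θ : ℝ) : Measure ℕ := poissonMeasure θ.toNNReal

/-- The joint law of `(x, θ, Y)` in the hierarchical model
`x ∼ μ`, `θ | x ∼ Ga(α, scale x)`, `Y | x, θ ∼ Poi(θ)`. -/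
def hierarchicalLaw {X : Type} [MeasurableSpace X] (α : ℝ) (μ : Measure X) (scale : X → ℝ) :
    Measure (X × ℝ × ℕ) :=
  μ.bind fun x => (gammaScale α (scale x)).bind fun θ =>
    (poissonMean θ).map fun y => (x, θ, y)

theorem measurable_gammaScale (α : ℝ) : Measurable (gammaScale α) := by
  refine Measure.measurable_of_measurable_coe _ fun s hs => ?_
  simp only [gammaScale, gammaMeasure, withDensity_apply _ hs]
  refine Measurable.lintegral_prod_right' (f := fun q : ℝ × ℝ => gammaPDF α (1 / q.1) q.2) ?_
  unfold gammaPDF gammaPDFReal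
  refine ENNReal.measurable_ofReal.comp (Measurable.ite ?_ (by fun_prop) measurable_const)
  exact measurableSet_le measurable_const measurable_snd

theorem measurable_poissonMean : Measurable poissonMean := by
  refine Measure.measurable_of_measurable_coe _ fun s _ => ?_
  simp only [poissonMean, poissonMeasure]
  simp only [Measure.sum_apply _ (MeasurableSet.of_discrete (s := s)), Measure.smul_apply]
  refine Measurable.tsum fun n => ?_
  fun_prop

/-- The maps used in `hierarchicalLaw` are measurable, so that the law is well defined. -/
theorem measurable_hierarchicalLaw_kernels {X : Type} [MeasurableSpace X] (α : ℝ) {scale : X → ℝ}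
    (hs : Measurable scale) :
    (∀ x : X, Measurable fun θ => (poissonMean θ).map fun y => (x, θ, y)) ∧
    Measurable fun x => (gammaScale α (scale x)).bind fun θ =>
      (poissonMean θ).map fun y => (x, θ, y) := by
  have hP : Measurable fun q : X × ℝ => (poissonMean q.2).map fun y => (q.1, q.2, y) := by
    refine Measure.measurable_of_measurable_coe _ fun s hs => ?_
    have : ∀ q : X × ℝ, ((poissonMean q.2).map fun y => (q.1, q.2, y)) s
        = ∑' y : ℕ, poissonMean q.2 {y} * s.indicator 1 (q.1, q.2, y) := by
      intro q
      have hm : Measurable fun y : ℕ => (q.1, q.2, y) := by fun_prop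
      rw [Measure.map_apply hm hs, ← lintegral_indicator_one (hm hs), lintegral_countable']
      refine tsum_congr fun y => ?_
      rw [mul_comm]; rfl
    simp only [this]
    refine Measurable.tsum fun y => Measurable.mul ?_ ?_
    · exact (Measure.measurable_coe (MeasurableSet.singleton y)).comp
        (measurable_poissonMean.comp measurable_snd)
    · exact (measurable_one.indicator hs).comp (by fun_prop)
  refine ⟨fun x => hP.comp (by fun_prop : Measurable fun θ : ℝ => (x, θ)), ?_⟩
  refine Measure.measurable_of_measurable_coe _ fun s hs' => ?_
  have h1 : ∀ x, ((gammaScale α (scale x)).bind fun θ =>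
      (poissonMean θ).map fun y => (x, θ, y)) s = ∫⁻ θ, gammaPDF α (1 / scale x) θ *
        ((poissonMean θ).map fun y => (x, θ, y)) s := by
    intro x
    have hx : Measurable fun θ => (poissonMean θ).map fun y => (x, θ, y) :=
      hP.comp (by fun_prop : Measurable fun θ : ℝ => (x, θ))
    rw [Measure.bind_apply hs' hx.aemeasurable, gammaScale, gammaMeasure,
      lintegral_withDensity_eq_lintegral_mul]
    · rfl
    · exact (measurable_gammaPDFReal _ _).ennreal_ofReal
    · exact (Measure.measurable_coe hs').comp hx
  simp only [h1]
  refine Measurable.lintegral_prod_right' (f := fun q : X × ℝ => gammaPDF α (1 / scale q.1) q.2 *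
        ((poissonMean q.2).map fun y => (q.1, q.2, y)) s) ?_
  refine Measurable.mul ?_ ((Measure.measurable_coe hs').comp hP)
  unfold gammaPDF gammaPDFReal
  refine ENNReal.measurable_ofReal.comp (Measurable.ite ?_ (by fun_prop) measurable_const)
  exact measurableSet_le measurable_const measurable_snd

theorem isProbabilityMeasure_hierarchicalLaw {X : Type} [MeasurableSpace X] {α : ℝ} (hα : 0 < α)
    (μ : Measure X) [IsProbabilityMeasure μ] {scale : X → ℝ} (hs : Measurable scale)
    (hpos : ∀ᵐ x ∂μ, 0 < scale x) :
    IsProbabilityMeasure (hierarchicalLaw α μ scale) := by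
  obtain ⟨h1, h2⟩ := measurable_hierarchicalLaw_kernels α hs
  constructor
  rw [hierarchicalLaw, Measure.bind_apply .univ h2.aemeasurable]
  have : ∀ᵐ x ∂μ, ((gammaScale α (scale x)).bind fun θ =>
      (poissonMean θ).map fun y => (x, θ, y)) univ = 1 := by
    filter_upwards [hpos] with x hx
    have := isProbabilityMeasure_gammaMeasure hα (one_div_pos.2 hx)
    rw [Measure.bind_apply .univ (h1 x).aemeasurable]
    have h3 : ∀ θ, ((poissonMean θ).map fun y => (x, θ, y)) univ = 1 := by
      intro θ
      rw [Measure.map_apply (by fun_prop) .univ]; simp [poissonMean]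
    simp only [h3, gammaScale, lintegral_const, measure_univ, mul_one]
  rw [lintegral_congr_ae this]; simp

/-- The law of a latent indicator `ν` with `P(ν = 1) = p` and `P(ν = 0) = 1 - p`. -/
def indicatorLaw (p : ℝ) : Measure Bool :=
  ENNReal.ofReal (1 - p) • Measure.dirac false + ENNReal.ofReal p • Measure.dirac true

/-- The two-group model for one coordinate: the law of `(ν, θ, Y)`, where `P(ν = 1) = p`,
`θ ∼ Ga(α, β)` under the null `ν = 0`, `θ ∼ Ga(α, β + δ)` under the alternative `ν = 1`, and
`Y ∼ Poi(θ)`. -/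
def twoGroupLaw (p α β δ : ℝ) : Measure (Bool × ℝ × ℕ) :=
  hierarchicalLaw α (indicatorLaw p) fun ν => if ν = true then β + δ else β

/-- The two-group model for `n` independent coordinates. -/
def twoGroupModel (n : ℕ) (p α β δ : ℝ) : Measure (Fin n → Bool × ℝ × ℕ) :=
  Measure.pi fun _ => twoGroupLaw p α β δ

/-- A multiple testing rule for `n` counts: `φ Y i` says that `H_{0i}` is rejected on data `Y`. -/
abbrev TestingRule (n : ℕ) : Type := (Fin n → ℕ) → Fin n → Prop

open Classical in
/-- The additive `0-1` loss of the rule `φ` for indicators `ν` and data `Y`: the number of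
coordinates at which `H_{0i} : ν i = 0` is wrongly rejected or wrongly accepted. -/
def additiveLoss {n : ℕ} (φ : TestingRule n) (ν : Fin n → Bool) (Y : Fin n → ℕ) : ℝ :=
  ∑ i, if φ Y i ↔ ν i = true then 0 else 1

/-- The Bayes risk of a multiple testing rule in the two-group model. -/
def bayesRisk {n : ℕ} (p α β δ : ℝ) (φ : TestingRule n) : ℝ :=
  ∫ ω, additiveLoss φ (fun i => (ω i).1) (fun i => (ω i).2.2) ∂(twoGroupModel n p α β δ)

/-- The threshold of the Bayes oracle. -/
def oracleThreshold (p α β δ : ℝ) : ℝ :=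
  (Real.log ((1 - p) / p) + α * Real.log ((β + δ + 1) / (β + 1))) /
    Real.log ((β + δ) * (β + 1) / (β * (β + δ + 1)))

/-- The Bayes oracle: reject `H_{0i}` if `Y i` exceeds the oracle threshold. -/
def oracleRule (n : ℕ) (p α β δ : ℝ) : TestingRule n :=
  fun Y i => oracleThreshold p α β δ < (Y i : ℝ)

/-- `R_Opt^BO`: the Bayes risk of the Bayes oracle. -/
def oracleRisk (n : ℕ) (p α β δ : ℝ) : ℝ :=
  bayesRisk p α β δ (oracleRule n p α β δ)

/-- Slow variation at infinity in Karamata's sense of a function on `(0, ∞)`. -/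
def SlowlyVarying (L : ℝ → ℝ) : Prop :=
  ∀ c : ℝ, 0 < c → Tendsto (fun x => L (c * x) / L x) atTop (𝓝 1)

/-- `π₁(t) = K t^{-a-1} L(t)`, `t > 0`, is a probability density, where `K > 0` and `L` is a
non-constant measurable slowly varying function from `(0, ∞)` to `(0, ∞)`. (Only the values of
`L` on `(0, ∞)` matter.) -/
structure IsLocalPrior (a K : ℝ) (L : ℝ → ℝ) : Prop where
  const_pos : 0 < K
  pos : ∀ t, 0 < t → 0 < L t
  measurable : Measurable fun t : Ioi (0 : ℝ) => L t
  nonconstant : ∃ s t, 0 < s ∧ 0 < t ∧ L s ≠ L t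
  slowlyVarying : SlowlyVarying L
  lintegral_eq_one : ∫⁻ t in Ioi (0 : ℝ), ENNReal.ofReal (K * t ^ (-a - 1) * L t) = 1

/-- Condition (A1): `L` is bounded below by a positive constant near infinity and has a limit in
`(0, ∞)` at infinity. -/
def ConditionA1 (L : ℝ → ℝ) : Prop :=
  (∃ c₀ t₀ : ℝ, 0 < c₀ ∧ 0 < t₀ ∧ ∀ t, t₀ ≤ t → c₀ ≤ L t) ∧
    ∃ ℓ : ℝ, 0 < ℓ ∧ Tendsto L atTop (𝓝 ℓ)

/-- Condition (A2): `L` is bounded above on `(0, ∞)`. -/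
def ConditionA2 (L : ℝ → ℝ) : Prop :=
  ∃ M : ℝ, 0 < M ∧ ∀ t, 0 < t → L t ≤ M

/-- The prior of the squared local shrinkage parameter `λ²`, with density
`K t^{-a-1} L(t)` on `(0, ∞)`. -/
def localPrior (a K : ℝ) (L : ℝ → ℝ) : Measure ℝ :=
  (volume.restrict (Ioi (0 : ℝ))).withDensity
    fun t => ENNReal.ofReal (K * t ^ (-a - 1) * L t)

/-- The one-group model for one coordinate given `τ`: the law of `(λ², θ, Y)`, where `λ²` has
the local prior, `θ | λ² ∼ Ga(α, λ² τ²)` and `Y | θ ∼ Poi(θ)`. -/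
def oneGroupLaw (α a K : ℝ) (L : ℝ → ℝ) (τ : ℝ) : Measure (ℝ × ℝ × ℕ) :=
  hierarchicalLaw α (localPrior a K L) fun v => v * τ ^ 2

/-- `E(κ | Y = y, τ)`: the posterior mean of `κ = 1 / (1 + λ² τ²)` in the one-group model, i.e.
its mean under the one-group law conditioned on the event `Y = y`. -/
def posteriorMeanKappa (α a K : ℝ) (L : ℝ → ℝ) (τ : ℝ) (y : ℕ) : ℝ :=
  ∫ x, 1 / (1 + x.1 * τ ^ 2) ∂(cond (oneGroupLaw α a K L τ) {x | x.2.2 = y})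

/-- The one-group rule: reject `H_{0i}` if `1 - E(κ_i | Y_i, τ) > δ / (2 (δ + 1))`. -/
def oneGroupRule (n : ℕ) (α δ a K : ℝ) (L : ℝ → ℝ) (τ : ℝ) : TestingRule n :=
  fun Y i => δ / (2 * (δ + 1)) < 1 - posteriorMeanKappa α a K L τ (Y i)

/-- `R_OG`: the Bayes risk, in the two-group model, of the one-group rule. -/
def oneGroupRisk (n : ℕ) (p α β δ a K : ℝ) (L : ℝ → ℝ) (τ : ℝ) : ℝ :=
  bayesRisk p α β δ (oneGroupRule n α δ a K L τ)

/-- `NB(α, q)`: the negative binomial distribution with size `α` and success probability `q`, whose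
mass at `y` is `Γ(y + α) / (Γ(α) y!) (1 - q)^y q^α`. -/
def negBinomial (α q : ℝ) : Measure ℕ :=
  Measure.sum fun y : ℕ =>
    ENNReal.ofReal (Real.Gamma (y + α) / (Real.Gamma α * y.factorial) * (1 - q) ^ y * q ^ α) •
      Measure.dirac y

end

/-!
The risk of a rule that decides each coordinate from its own count is `n` times a one-coordinate
risk. Integrating out `θ` makes the count negative binomial, `NB(α, 1 / (1 + β))` under the null and
`NB(α, 1 / (1 + β + δ))` under the alternative (`bind_poissonMean_gammaScale`,
`bayesRisk_coordinatewise`), so this risk is `1 - p` times the null probability of rejection plus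
`p` times the alternative probability of acceptance.

The null puts mass at most `α β` on nonzero counts, and `β = o(p)` because `C₁ > 1`. Hence a rule
that accepts at the count `0` has false positives of order `o(p)`, and its risk is governed by its
false negatives. The oracle threshold lies eventually in `[0, 1)`, so the oracle rejects exactly the
nonzero counts, with risk `n p (δ + 1) ^ (-α) (1 + o(1))` (`tendsto_oracleRisk_div`).

For the one-group rule, put `u = λ² τ²`. Given the count `y`, the posterior density of `u` is
proportional to `u ^ (-a - 1) L(u / τ²) (u / (1 + u)) ^ y (1 + u) ^ (-α)`. When `y > a` this is
dominated uniformly in `τ`, and since `L` has a positive limit it converges to a Beta prime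
density, so that `E(κ | y, τ) → (a + α) / (y + α)` (`tendsto_posteriorMeanKappa`). At `y = 0` the
posterior of `λ²` tends to its prior and `E(κ | 0, τ) → 1` (`tendsto_posteriorMeanKappa_zero`).
The rule therefore eventually accepts at `0` and rejects every fixed count above the cutoff
`2 a + α - 2 (a + α) / (δ + 2)` (`cutoff_lt_iff`). Accepting at `0` alone costs as much as the
oracle's false negatives, which is the lower bound. The upper bound is the cost of accepting at
every count up to the cutoff; the counts above it contribute nothing in the limit, by dominated
convergence (`tendsto_negBinomial_real`).
-/

/-! ### The negative binomial law as a Gamma mixture of Poisson laws -/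

theorem negBinomial_singleton (α q : ℝ) (y : ℕ) : negBinomial α q {y} =
    ENNReal.ofReal (Real.Gamma (y + α) / (Real.Gamma α * y.factorial) * (1 - q) ^ y * q ^ α) := by
  rw [negBinomial, Measure.sum_smul_dirac_singleton]

theorem negBinomial_real_singleton {α q : ℝ} (hα : 0 < α) (hq : 0 ≤ q) (hq1 : q ≤ 1) (y : ℕ) :
    (negBinomial α q).real {y} =
      Real.Gamma (y + α) / (Real.Gamma α * y.factorial) * (1 - q) ^ y * q ^ α := by
  have h1 : 0 < Real.Gamma (y + α) := Real.Gamma_pos_of_pos (by positivity)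
  have h2 : 0 < Real.Gamma α := Real.Gamma_pos_of_pos hα
  have h3 : 0 ≤ 1 - q := by linarith
  rw [measureReal_def, negBinomial_singleton, ENNReal.toReal_ofReal (by positivity)]

/-- The Gamma density integrated against the Poisson mass at `y` is again a Gamma integral, with
shape `α + y` and rate `1 / s + 1`. -/
theorem lintegral_poissonMean_gammaScale {α s : ℝ} (hα : 0 < α) (hs : 0 < s) (y : ℕ) :
    ∫⁻ θ, poissonMean θ {y} ∂(gammaScale α s) = negBinomial α (1 / (1 + s)) {y} := by
  have hΓ : 0 < Real.Gamma α := Real.Gamma_pos_of_pos hα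
  have hm : Measurable fun θ => poissonMean θ {y} :=
    (Measure.measurable_coe (MeasurableSet.singleton y)).comp measurable_poissonMean
  have hpdf : Measurable (gammaPDF α (1 / s)) := (measurable_gammaPDFReal _ _).ennreal_ofReal
  rw [gammaScale, gammaMeasure, lintegral_withDensity_eq_lintegral_mul _ hpdf hm]
  have h1 : ∫⁻ θ, ((gammaPDF α (1 / s)) * fun θ => poissonMean θ {y}) θ =
      ∫⁻ θ in Ioi (0 : ℝ), ENNReal.ofReal ((1 / s) ^ α / Real.Gamma α / y.factorial *
        (θ ^ (α + y - 1) * Real.exp (-((1 / s + 1) * θ)))) := by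
    rw [← lintegral_indicator measurableSet_Ioi]
    have h0 : ∀ᵐ θ : ℝ ∂volume, θ ≠ 0 := by simp [ae_iff]
    refine lintegral_congr_ae ?_
    filter_upwards [h0] with θ hθ
    rcases lt_or_gt_of_ne hθ with h | h
    · simp [gammaPDF, gammaPDFReal, not_le.2 h, h.le]
    · rw [indicator_of_mem (mem_Ioi.2 h), Pi.mul_apply, gammaPDF, gammaPDFReal, if_pos h.le,
        poissonMean, poissonMeasure_singleton, ← ENNReal.ofReal_mul (by positivity),
        Real.coe_toNNReal _ h.le]
      congr 1
      rw [show α + y - 1 = (α - 1) + y by ring, Real.rpow_add h, Real.rpow_natCast,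
        show -((1 / s + 1) * θ) = -(1 / s * θ) + -θ by ring, Real.exp_add]
      ring
  have hg := Real.integral_rpow_mul_exp_neg_mul_Ioi (a := α + y) (r := 1 / s + 1)
    (by positivity) (by positivity)
  rw [h1, ← ofReal_integral_eq_lintegral_ofReal, integral_const_mul, hg, negBinomial_singleton]
  · congr 1
    have e1 : 1 / (1 / s + 1) = s * (1 / (1 + s)) := by field_simp
    have e2 : 1 - 1 / (1 + s) = s * (1 / (1 + s)) := by field_simp; ring
    rw [e1, e2, Real.rpow_add (by positivity), Real.rpow_natCast, Real.mul_rpow hs.le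
      (by positivity), Real.div_rpow zero_le_one hs.le, add_comm α (y : ℝ)]
    have : s ^ α ≠ 0 := (Real.rpow_pos_of_pos hs _).ne'
    rw [Real.one_rpow]
    field_simp
  · refine Integrable.const_mul (.of_integral_ne_zero ?_) _
    rw [hg]
    have : 0 < Real.Gamma (α + y) := Real.Gamma_pos_of_pos (by positivity)
    positivity
  · refine (ae_restrict_iff' measurableSet_Ioi).2 (ae_of_all _ fun θ (hθ : 0 < θ) => ?_)
    simp only [Pi.zero_apply]
    positivity

/-- A Gamma mixture of Poisson laws is negative binomial. -/
theorem bind_poissonMean_gammaScale {α s : ℝ} (hα : 0 < α) (hs : 0 < s) :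
    (gammaScale α s).bind poissonMean = negBinomial α (1 / (1 + s)) := by
  refine Measure.ext_of_singleton fun y => ?_
  rw [Measure.bind_apply (MeasurableSet.singleton y) measurable_poissonMean.aemeasurable,
    lintegral_poissonMean_gammaScale hα hs]

theorem isProbabilityMeasure_negBinomial {α s : ℝ} (hα : 0 < α) (hs : 0 < s) :
    IsProbabilityMeasure (negBinomial α (1 / (1 + s))) := by
  have : IsProbabilityMeasure (gammaScale α s) :=
    isProbabilityMeasure_gammaMeasure hα (one_div_pos.2 hs)
  refine ⟨?_⟩
  rw [← bind_poissonMean_gammaScale hα hs, Measure.bind_apply .univ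
    measurable_poissonMean.aemeasurable]
  simp [poissonMean]

/-- Integrating `θ` out of the hierarchical model leaves a negative binomial count given `x`. -/
theorem lintegral_hierarchicalLaw {X : Type} [MeasurableSpace X] {α : ℝ} (hα : 0 < α)
    (μ : Measure X) {scale : X → ℝ} (hs : Measurable scale) (hpos : ∀ᵐ x ∂μ, 0 < scale x)
    {f : X × ℕ → ℝ≥0∞} (hf : Measurable f) :
    ∫⁻ z, f (z.1, z.2.2) ∂(hierarchicalLaw α μ scale) =
      ∫⁻ x, ∫⁻ y, f (x, y) ∂(negBinomial α (1 / (1 + scale x))) ∂μ := by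
  obtain ⟨h1, h2⟩ := measurable_hierarchicalLaw_kernels α hs
  have hf' : Measurable fun z : X × ℝ × ℕ => f (z.1, z.2.2) := hf.comp (by fun_prop)
  rw [hierarchicalLaw, Measure.lintegral_bind h2.aemeasurable hf'.aemeasurable]
  refine lintegral_congr_ae ?_
  filter_upwards [hpos] with x hx
  have hfx : Measurable fun y : ℕ => f (x, y) := .of_discrete
  rw [Measure.lintegral_bind (h1 x).aemeasurable hf'.aemeasurable,
    ← bind_poissonMean_gammaScale hα hx,
    Measure.lintegral_bind measurable_poissonMean.aemeasurable hfx.aemeasurable]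
  refine lintegral_congr fun θ => ?_
  rw [lintegral_map hf' (by fun_prop)]

/-- An almost sure property of `x` under its prior holds almost surely in the hierarchical model. -/
theorem ae_hierarchicalLaw_fst {X : Type} [MeasurableSpace X] {α : ℝ} (hα : 0 < α)
    {μ : Measure X} {scale : X → ℝ} (hs : Measurable scale) (hpos : ∀ᵐ x ∂μ, 0 < scale x)
    {P : X → Prop} (hP : MeasurableSet {x | P x}) (h : ∀ᵐ x ∂μ, P x) :
    ∀ᵐ z ∂(hierarchicalLaw α μ scale), P z.1 := by
  have hc : MeasurableSet {z : X × ℝ × ℕ | ¬ P z.1} := measurable_fst hP.compl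
  have hf : Measurable fun q : X × ℕ => ({x | P x}ᶜ.indicator 1 q.1 : ℝ≥0∞) :=
    (measurable_one.indicator hP.compl).comp measurable_fst
  rw [ae_iff, ← lintegral_indicator_one hc]
  refine (lintegral_hierarchicalLaw hα μ hs hpos hf).trans ?_
  refine (lintegral_congr_ae (g := 0) ?_).trans (by simp)
  filter_upwards [h] with x hx
  simp [hx]

/-! ### The Bayes risk of a rule that decides each coordinate from its own count -/

theorem lintegral_indicatorLaw (p : ℝ) (f : Bool → ℝ≥0∞) :
    ∫⁻ b, f b ∂(indicatorLaw p) = ENNReal.ofReal (1 - p) * f false + ENNReal.ofReal p * f true := by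
  simp [indicatorLaw, lintegral_add_measure, lintegral_smul_measure]

theorem isProbabilityMeasure_indicatorLaw {p : ℝ} (h0 : 0 ≤ p) (h1 : p ≤ 1) :
    IsProbabilityMeasure (indicatorLaw p) := by
  refine ⟨?_⟩
  rw [← lintegral_one, lintegral_indicatorLaw, mul_one, mul_one,
    ← ENNReal.ofReal_add (by linarith) h0]
  simp

open Classical in
theorem integral_misclassification_twoGroupLaw {p α β δ : ℝ} (h0 : 0 ≤ p) (h1 : p ≤ 1)
    (hα : 0 < α) (hβ : 0 < β) (hδ : 0 < δ) (D : ℕ → Prop) :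
    ∫ z, (if D z.2.2 ↔ z.1 = true then (0 : ℝ) else 1) ∂(twoGroupLaw p α β δ) =
      (1 - p) * (negBinomial α (1 / (1 + β))).real {y | D y} +
        p * (negBinomial α (1 / (1 + (β + δ)))).real {y | ¬ D y} := by
  have hscale : ∀ ν : Bool, 0 < if ν = true then β + δ else β := by
    intro ν; split_ifs <;> positivity
  have := isProbabilityMeasure_negBinomial hα hβ
  have := isProbabilityMeasure_negBinomial hα (add_pos hβ hδ)
  have hf : Measurable fun q : Bool × ℕ => if D q.2 ↔ q.1 = true then (0 : ℝ≥0∞) else 1 :=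
    .of_discrete
  have hg : Measurable fun z : Bool × ℝ × ℕ => if D z.2.2 ↔ z.1 = true then (0 : ℝ) else 1 := by
    have : Measurable fun q : Bool × ℕ => if D q.2 ↔ q.1 = true then (0 : ℝ) else 1 := .of_discrete
    exact this.comp (by fun_prop : Measurable fun z : Bool × ℝ × ℕ => (z.1, z.2.2))
  rw [integral_eq_lintegral_of_nonneg_ae
    (ae_of_all _ fun z => by simp only [Pi.zero_apply]; split_ifs <;> norm_num)
    hg.aestronglyMeasurable]
  have e : ∀ z : Bool × ℝ × ℕ, ENNReal.ofReal (if D z.2.2 ↔ z.1 = true then (0 : ℝ) else 1) =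
      (if D z.2.2 ↔ z.1 = true then (0 : ℝ≥0∞) else 1) := by
    intro z; split_ifs <;> simp
  simp only [e]
  rw [twoGroupLaw, lintegral_hierarchicalLaw hα _ .of_discrete (ae_of_all _ hscale) hf,
    lintegral_indicatorLaw]
  have i1 : ∀ y : ℕ, (if D y ↔ False then (0 : ℝ≥0∞) else 1) = {y | D y}.indicator 1 y := by
    intro y; by_cases h : D y <;> simp [h]
  have i2 : ∀ y : ℕ, (if D y ↔ True then (0 : ℝ≥0∞) else 1) = {y | ¬ D y}.indicator 1 y := by
    intro y; by_cases h : D y <;> simp [h]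
  simp only [Bool.false_eq_true, if_false, if_true, i1, i2,
    lintegral_indicator_one (MeasurableSet.of_discrete)]
  rw [ENNReal.toReal_add (by finiteness) (by finiteness), ENNReal.toReal_mul, ENNReal.toReal_mul,
    ENNReal.toReal_ofReal (by linarith), ENNReal.toReal_ofReal h0]
  rfl

/-- By linearity, only the law of a single coordinate enters the risk of a rule that treats the
coordinates separately. -/
theorem bayesRisk_coordinatewise {n : ℕ} {p α β δ : ℝ} (h0 : 0 ≤ p) (h1 : p ≤ 1)
    (hα : 0 < α) (hβ : 0 < β) (hδ : 0 < δ) (D : ℕ → Prop) :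
    bayesRisk (n := n) p α β δ (fun Y i => D (Y i)) =
      n * ((1 - p) * (negBinomial α (1 / (1 + β))).real {y | D y} +
        p * (negBinomial α (1 / (1 + (β + δ)))).real {y | ¬ D y}) := by
  classical
  have hscale : ∀ ν : Bool, 0 < if ν = true then β + δ else β := by
    intro ν; split_ifs <;> positivity
  have := isProbabilityMeasure_indicatorLaw h0 h1
  have : IsProbabilityMeasure (twoGroupLaw p α β δ) :=
    isProbabilityMeasure_hierarchicalLaw hα _ .of_discrete (ae_of_all _ hscale)
  let g : Bool × ℝ × ℕ → ℝ := fun z => if D z.2.2 ↔ z.1 = true then (0 : ℝ) else 1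
  have hg : Measurable g := by
    have : Measurable fun q : Bool × ℕ => if D q.2 ↔ q.1 = true then (0 : ℝ) else 1 := .of_discrete
    exact this.comp (by fun_prop : Measurable fun z : Bool × ℝ × ℕ => (z.1, z.2.2))
  have hb : ∀ z, ‖g z‖ ≤ 1 := by
    intro z; simp only [g]; split_ifs <;> norm_num
  have hi : ∀ i : Fin n, Integrable (fun ω : Fin n → Bool × ℝ × ℕ => g (ω i))
      (twoGroupModel n p α β δ) := by
    intro i
    unfold twoGroupModel
    exact .of_bound (hg.comp (measurable_pi_apply i)).aestronglyMeasurable 1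
      (ae_of_all _ fun ω => hb _)
  have he : ∀ i : Fin n, ∫ ω, g (ω i) ∂(twoGroupModel n p α β δ) =
      ∫ z, g z ∂(twoGroupLaw p α β δ) := by
    intro i
    have hmp := measurePreserving_eval (fun _ : Fin n => twoGroupLaw p α β δ) i
    rw [← hmp.map_eq, integral_map hmp.measurable.aemeasurable hg.aestronglyMeasurable]
    rfl
  have hsum : bayesRisk (n := n) p α β δ (fun Y i => D (Y i)) =
      ∫ ω, ∑ i, g (ω i) ∂(twoGroupModel n p α β δ) := by
    unfold _root_.bayesRisk additiveLoss
    refine integral_congr_ae (ae_of_all _ fun ω => ?_)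
    refine Finset.sum_congr rfl fun i _ => ?_
    simp only [g]
  rw [hsum, integral_finsetSum _ fun i _ => hi i]
  simp only [he, Finset.sum_const, Finset.card_univ, Fintype.card_fin, nsmul_eq_mul, g]
  rw [integral_misclassification_twoGroupLaw h0 h1 hα hβ hδ]

/-! ### The Bayes oracle -/

theorem negBinomial_real_singleton_zero {α s : ℝ} (hα : 0 < α) (hs : 0 < s) :
    (negBinomial α (1 / (1 + s))).real {0} = (1 + s) ^ (-α) := by
  have h2 : 0 < Real.Gamma α := Real.Gamma_pos_of_pos hα
  rw [negBinomial_real_singleton hα (by positivity)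
    ((div_le_one (by positivity)).2 (by linarith))]
  simp only [Nat.cast_zero, zero_add, Nat.factorial_zero, Nat.cast_one, mul_one, pow_zero]
  rw [div_self h2.ne', one_mul, one_div, Real.inv_rpow (by positivity),
    Real.rpow_neg (by positivity)]

theorem negBinomial_real_ne_zero_le {α s : ℝ} (hα : 0 < α) (hs : 0 < s) :
    (negBinomial α (1 / (1 + s))).real {y | y ≠ 0} ≤ α * s := by
  have := isProbabilityMeasure_negBinomial hα hs
  have e : {y : ℕ | y ≠ 0} = {0}ᶜ := rfl
  rw [e, probReal_compl_eq_one_sub (MeasurableSet.singleton 0),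
    negBinomial_real_singleton_zero hα hs, Real.rpow_def_of_pos (by positivity)]
  have h1 := Real.add_one_le_exp (Real.log (1 + s) * -α)
  have h2 := Real.log_le_sub_one_of_pos (show 0 < 1 + s by positivity)
  nlinarith

theorem tendsto_div_of_tendsto_div_rpow {p β : ℕ → ℝ} {C c : ℝ} (hp : ∀ n, 0 < p n)
    (hp_lim : Tendsto p atTop (𝓝 0)) (hC : 1 < C)
    (hβ_lim : Tendsto (fun n => β n / p n ^ C) atTop (𝓝 c)) :
    Tendsto (fun n => β n / p n) atTop (𝓝 0) := by
  have h1 : Tendsto (fun n => p n ^ (C - 1)) atTop (𝓝 0) := by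
    have := hp_lim.rpow_const (p := C - 1) (Or.inr (by linarith))
    rwa [Real.zero_rpow (by linarith)] at this
  have h2 := hβ_lim.mul h1
  rw [mul_zero] at h2
  refine h2.congr fun n => ?_
  rw [Real.rpow_sub_one (hp n).ne']
  have : 0 < p n ^ C := Real.rpow_pos_of_pos (hp n) _
  have := hp n
  field_simp

/-- The oracle threshold is eventually in `[0, 1)`: it is below `1` as soon as the quotient of the
numerator's and the denominator's exponentials, of order `β / p`, is below `1`. -/
theorem eventually_oracleThreshold_mem_Ico {p β : ℕ → ℝ} {α δ : ℝ} (hα : 0 < α) (hδ : 0 < δ)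
    (hp : ∀ n, 0 < p n ∧ p n < 1) (hp_lim : Tendsto p atTop (𝓝 0)) (hβ : ∀ n, 0 < β n)
    (hβ0 : Tendsto β atTop (𝓝 0)) (hβp : Tendsto (fun n => β n / p n) atTop (𝓝 0)) :
    ∀ᶠ n in atTop, 0 ≤ oracleThreshold (p n) α (β n) δ ∧ oracleThreshold (p n) α (β n) δ < 1 := by
  have hX : Tendsto (fun n => (1 - p n) * (β n / p n) * ((β n + δ + 1) / (β n + 1)) ^ α *
      ((β n + δ + 1) / ((β n + δ) * (β n + 1)))) atTop (𝓝 0) := by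
    have hb : Tendsto (fun n => (β n + δ + 1) / (β n + 1)) atTop (𝓝 ((0 + δ + 1) / (0 + 1))) :=
      ((hβ0.add_const δ).add_const 1).div (hβ0.add_const 1) (by norm_num)
    have hb' : Tendsto (fun n => (β n + δ + 1) / ((β n + δ) * (β n + 1))) atTop
        (𝓝 ((0 + δ + 1) / ((0 + δ) * (0 + 1)))) :=
      ((hβ0.add_const δ).add_const 1).div ((hβ0.add_const δ).mul (hβ0.add_const 1))
        (by simpa using hδ.ne')
    have := (((hp_lim.const_sub 1).mul hβp).mul (hb.rpow_const (p := α) (Or.inr hα.le))).mul hb'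
    simpa using this
  filter_upwards [hX.eventually_lt_const one_pos, hp_lim.eventually_le_const (u := 1 / 2)
    (by norm_num)] with n hn hn2
  obtain ⟨hp0, hp1⟩ := hp n
  have hb := hβ n
  have h1p : 0 < 1 - p n := by linarith
  have hden : 0 < Real.log ((β n + δ) * (β n + 1) / (β n * (β n + δ + 1))) := by
    refine Real.log_pos ((one_lt_div (by positivity)).2 ?_)
    nlinarith
  have hn1 : 0 ≤ Real.log ((1 - p n) / p n) :=
    Real.log_nonneg ((one_le_div hp0).2 (by linarith))
  have hn3 : 0 ≤ Real.log ((β n + δ + 1) / (β n + 1)) :=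
    Real.log_nonneg ((one_le_div (by positivity)).2 (by linarith))
  refine ⟨div_nonneg (by positivity) hden.le, (div_lt_one hden).2 ?_⟩
  rw [← Real.log_rpow (by positivity), ← Real.log_mul (by positivity) (by positivity)]
  refine Real.log_lt_log (by positivity) ?_
  rw [lt_div_iff₀ (by positivity)]
  have e : (1 - p n) * (β n / p n) * ((β n + δ + 1) / (β n + 1)) ^ α *
      ((β n + δ + 1) / ((β n + δ) * (β n + 1))) =
      ((1 - p n) / p n * ((β n + δ + 1) / (β n + 1)) ^ α * (β n * (β n + δ + 1))) /
        ((β n + δ) * (β n + 1)) := by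
    field_simp
  rwa [e, div_lt_one (by positivity)] at hn

/-- The threshold being in `[0, 1)`, the oracle rejects exactly when the count is nonzero. -/
theorem oracleRisk_eq {n : ℕ} {p α β δ : ℝ} (h0 : 0 ≤ p) (h1 : p ≤ 1)
    (hα : 0 < α) (hβ : 0 < β) (hδ : 0 < δ) (ht0 : 0 ≤ oracleThreshold p α β δ)
    (ht1 : oracleThreshold p α β δ < 1) :
    oracleRisk n p α β δ = n * ((1 - p) * (negBinomial α (1 / (1 + β))).real {y | y ≠ 0} +
        p * (1 + (β + δ)) ^ (-α)) := by
  have e : oracleRule n p α β δ = fun Y i => Y i ≠ 0 := by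
    funext Y i
    rw [oracleRule, eq_iff_iff]
    constructor
    · rintro h h'
      rw [h', Nat.cast_zero] at h
      exact absurd h (not_lt.2 ht0)
    · intro h
      exact ht1.trans_le (by exact_mod_cast Nat.one_le_iff_ne_zero.2 h)
  rw [oracleRisk, e, bayesRisk_coordinatewise h0 h1 hα hβ hδ fun y => y ≠ 0,
    ← negBinomial_real_singleton_zero hα (add_pos hβ hδ)]
  congr 4
  ext y
  simp

/-- Rescaled by `n p`, the risk of the oracle comes from the false negatives alone. -/
theorem tendsto_oracleRisk_div {p β : ℕ → ℝ} {α δ : ℝ} (hα : 0 < α) (hδ : 0 < δ)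
    (hp : ∀ n, 0 < p n ∧ p n < 1) (hp_lim : Tendsto p atTop (𝓝 0)) (hβ : ∀ n, 0 < β n)
    (hβ0 : Tendsto β atTop (𝓝 0)) (hβp : Tendsto (fun n => β n / p n) atTop (𝓝 0)) :
    Tendsto (fun n : ℕ => oracleRisk n (p n) α (β n) δ / (n * p n)) atTop
      (𝓝 ((δ + 1) ^ (-α))) := by
  have hb : Tendsto (fun n => (1 + (β n + δ)) ^ (-α)) atTop (𝓝 ((δ + 1) ^ (-α))) := by
    have h := ((hβ0.add_const δ).const_add 1).rpow_const (p := -α) (Or.inl (by linarith))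
    rwa [show 1 + (0 + δ) = δ + 1 by ring] at h
  have hz : Tendsto (fun n => (1 - p n) * (negBinomial α (1 / (1 + β n))).real {y | y ≠ 0} / p n)
      atTop (𝓝 0) := by
    have h := hβp.const_mul α
    rw [mul_zero] at h
    refine squeeze_zero (fun n => ?_) (fun n => ?_) h
    · have : 0 ≤ 1 - p n := by linarith [(hp n).2]
      have := (hp n).1
      positivity
    · have h1 := negBinomial_real_ne_zero_le hα (hβ n)
      rw [← mul_div_assoc]
      refine div_le_div_of_nonneg_right ?_ (hp n).1.le
      exact (mul_le_of_le_one_left measureReal_nonneg (by linarith [(hp n).1])).trans h1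
  have hsum := hz.add hb
  rw [zero_add] at hsum
  refine hsum.congr' ?_
  filter_upwards [eventually_oracleThreshold_mem_Ico hα hδ hp hp_lim hβ hβ0 hβp,
    eventually_gt_atTop 0] with n hn hn0
  rw [oracleRisk_eq (hp n).1.le (hp n).2.le hα (hβ n) hδ hn.1 hn.2]
  have := (hp n).1
  have : (0 : ℝ) < n := by exact_mod_cast hn0
  field_simp

/-! ### The posterior mean of the shrinkage factor -/

/-- With `v = λ² τ²`, the likelihood of the count `y` given `λ²`, up to a constant, times
`(1 + v) ^ (α - b)`: the choices `b = α` and `b = α + 1` give the likelihood and the likelihood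
times `κ`. -/
noncomputable def shrinkageWeight (y : ℕ) (b v : ℝ) : ℝ := (v / (1 + v)) ^ y * (1 + v) ^ (-b)

theorem measurable_shrinkageWeight (y : ℕ) (b : ℝ) : Measurable (shrinkageWeight y b) := by
  unfold shrinkageWeight
  fun_prop

theorem shrinkageWeight_pos {y : ℕ} {b v : ℝ} (hv : 0 < v) : 0 < shrinkageWeight y b v := by
  unfold shrinkageWeight
  positivity

theorem aemeasurable_of_isLocalPrior {a K : ℝ} {L : ℝ → ℝ} (hL : IsLocalPrior a K L) :
    AEMeasurable L (volume.restrict (Ioi (0 : ℝ))) :=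
  (aemeasurable_restrict_iff_comap_subtype measurableSet_Ioi).2 hL.measurable.aemeasurable

theorem aemeasurable_localPrior_density {a K : ℝ} {L : ℝ → ℝ} (hL : IsLocalPrior a K L) :
    AEMeasurable (fun t => ENNReal.ofReal (K * t ^ (-a - 1) * L t))
      (volume.restrict (Ioi (0 : ℝ))) := by
  have := aemeasurable_of_isLocalPrior hL
  fun_prop

theorem isProbabilityMeasure_localPrior {a K : ℝ} {L : ℝ → ℝ} (hL : IsLocalPrior a K L) :
    IsProbabilityMeasure (localPrior a K L) := by
  refine ⟨?_⟩
  rw [localPrior, withDensity_apply _ .univ, Measure.restrict_univ]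
  exact hL.lintegral_eq_one

theorem ae_localPrior_pos (a K : ℝ) (L : ℝ → ℝ) : ∀ᵐ t ∂(localPrior a K L), 0 < t :=
  (withDensity_absolutelyContinuous _ _).ae_le (ae_restrict_mem measurableSet_Ioi)

theorem integral_localPrior {a K : ℝ} {L : ℝ → ℝ} (hL : IsLocalPrior a K L) (f : ℝ → ℝ) :
    ∫ t, f t ∂(localPrior a K L) = ∫ t in Ioi (0 : ℝ), K * t ^ (-a - 1) * L t * f t := by
  rw [localPrior, integral_withDensity_eq_integral_toReal_smul₀
    (aemeasurable_localPrior_density hL) (ae_of_all _ fun t => ENNReal.ofReal_lt_top)]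
  refine setIntegral_congr_fun measurableSet_Ioi fun t (ht : 0 < t) => ?_
  have := hL.pos t ht
  have := hL.const_pos
  simp only [smul_eq_mul]
  rw [ENNReal.toReal_ofReal (by positivity)]

theorem setLIntegral_oneGroupLaw {α a K τ : ℝ} {L : ℝ → ℝ} (hα : 0 < α) (hτ : 0 < τ) (y : ℕ)
    {h : ℝ → ℝ≥0∞} (hh : Measurable h) :
    ∫⁻ x in {x | x.2.2 = y}, h x.1 ∂(oneGroupLaw α a K L τ) =
      ∫⁻ t, h t * negBinomial α (1 / (1 + t * τ ^ 2)) {y} ∂(localPrior a K L) := by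
  have hS : MeasurableSet {x : ℝ × ℝ × ℕ | x.2.2 = y} :=
    (measurable_snd.comp measurable_snd) (MeasurableSet.singleton y)
  have hpos : ∀ᵐ t ∂(localPrior a K L), 0 < t * τ ^ 2 := by
    filter_upwards [ae_localPrior_pos a K L] with t ht
    positivity
  have hf : Measurable fun q : ℝ × ℕ => ({q : ℝ × ℕ | q.2 = y}.indicator (fun q => h q.1) q) :=
    (hh.comp measurable_fst).indicator (measurable_snd (MeasurableSet.singleton y))
  rw [← lintegral_indicator hS]
  refine (lintegral_hierarchicalLaw hα (localPrior a K L) (scale := fun v => v * τ ^ 2)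
    (by fun_prop) hpos hf).trans ?_
  refine lintegral_congr fun t => ?_
  rw [← lintegral_indicator_const (MeasurableSet.singleton y)]
  rfl

theorem toReal_lintegral_shrinkage {α a K τ b : ℝ} {L : ℝ → ℝ} (hα : 0 < α) (hτ : 0 < τ) (y : ℕ)
    {h : ℝ → ℝ≥0∞} (hb : ∀ t, 0 < t → h t = ENNReal.ofReal ((1 + t * τ ^ 2) ^ (α - b))) :
    (∫⁻ t, h t * negBinomial α (1 / (1 + t * τ ^ 2)) {y} ∂(localPrior a K L)).toReal =
      Real.Gamma (y + α) / (Real.Gamma α * y.factorial) *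
        ∫ t, shrinkageWeight y b (t * τ ^ 2) ∂(localPrior a K L) := by
  have h1 : 0 < Real.Gamma (y + α) := Real.Gamma_pos_of_pos (by positivity)
  have h2 : 0 < Real.Gamma α := Real.Gamma_pos_of_pos hα
  have hm : Measurable fun t : ℝ => shrinkageWeight y b (t * τ ^ 2) :=
    (measurable_shrinkageWeight y b).comp (by fun_prop)
  rw [← integral_const_mul, integral_eq_lintegral_of_nonneg_ae _
    (hm.const_mul _).aestronglyMeasurable]
  · congr 1
    refine lintegral_congr_ae ?_
    filter_upwards [ae_localPrior_pos a K L] with t ht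
    have hv : 0 < t * τ ^ 2 := by positivity
    have e : 1 - 1 / (1 + t * τ ^ 2) = t * τ ^ 2 / (1 + t * τ ^ 2) := by field_simp; ring
    rw [hb t ht, negBinomial_singleton, ← ENNReal.ofReal_mul (by positivity), e,
      shrinkageWeight, one_div, Real.inv_rpow (by positivity), sub_eq_add_neg α b,
      Real.rpow_add (by positivity)]
    congr 1
    have : (1 + t * τ ^ 2) ^ α ≠ 0 := (Real.rpow_pos_of_pos (by positivity) _).ne'
    field_simp
  · filter_upwards [ae_localPrior_pos a K L] with t ht
    have := shrinkageWeight_pos (y := y) (b := b) (show 0 < t * τ ^ 2 by positivity)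
    simp only [Pi.zero_apply]
    positivity

/-- Bayes' formula for the posterior mean of `κ`. -/
theorem posteriorMeanKappa_eq {α a K τ : ℝ} {L : ℝ → ℝ} (hα : 0 < α) (hτ : 0 < τ) (y : ℕ) :
    posteriorMeanKappa α a K L τ y =
      (∫ t, shrinkageWeight y (α + 1) (t * τ ^ 2) ∂(localPrior a K L)) /
        ∫ t, shrinkageWeight y α (t * τ ^ 2) ∂(localPrior a K L) := by
  have h1 : 0 < Real.Gamma (y + α) := Real.Gamma_pos_of_pos (by positivity)
  have h2 : 0 < Real.Gamma α := Real.Gamma_pos_of_pos hα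
  have hpos : ∀ᵐ t ∂(localPrior a K L), 0 < t * τ ^ 2 := by
    filter_upwards [ae_localPrior_pos a K L] with t ht
    positivity
  have hk : Measurable fun t : ℝ => 1 / (1 + t * τ ^ 2) := by fun_prop
  have hnn : ∀ᵐ x ∂(oneGroupLaw α a K L τ), 0 ≤ 1 / (1 + x.1 * τ ^ 2) := by
    refine ae_hierarchicalLaw_fst (P := fun t : ℝ => 0 ≤ 1 / (1 + t * τ ^ 2)) hα (by fun_prop) hpos
      (measurableSet_le measurable_const hk) ?_
    filter_upwards [hpos] with t ht
    positivity
  have hN : ∫ x in {x | x.2.2 = y}, 1 / (1 + x.1 * τ ^ 2) ∂(oneGroupLaw α a K L τ) =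
      Real.Gamma (y + α) / (Real.Gamma α * y.factorial) *
        ∫ t, shrinkageWeight y (α + 1) (t * τ ^ 2) ∂(localPrior a K L) := by
    rw [integral_eq_lintegral_of_nonneg_ae (ae_restrict_of_ae hnn)
      (hk.comp measurable_fst).aestronglyMeasurable,
      setLIntegral_oneGroupLaw (h := fun t => ENNReal.ofReal (1 / (1 + t * τ ^ 2))) hα hτ y
        hk.ennreal_ofReal]
    refine toReal_lintegral_shrinkage hα hτ y fun t ht => ?_
    rw [show α - (α + 1) = -1 by ring, Real.rpow_neg_one, one_div]
  have hD : (oneGroupLaw α a K L τ {x | x.2.2 = y}).toReal =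
      Real.Gamma (y + α) / (Real.Gamma α * y.factorial) *
        ∫ t, shrinkageWeight y α (t * τ ^ 2) ∂(localPrior a K L) := by
    rw [← setLIntegral_one, setLIntegral_oneGroupLaw (h := fun _ => 1) hα hτ y measurable_const]
    exact toReal_lintegral_shrinkage hα hτ y fun t ht => by simp
  rw [posteriorMeanKappa, ProbabilityTheory.cond, integral_smul_measure, hN, ENNReal.toReal_inv,
    hD, smul_eq_mul]
  have : Real.Gamma (y + α) / (Real.Gamma α * y.factorial) ≠ 0 := by positivity
  rw [← div_eq_inv_mul, mul_div_mul_left _ _ this]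

/-! ### The posterior mean as `τ → 0` -/

theorem shrinkageWeight_le_one {y : ℕ} {b v : ℝ} (hb : 0 ≤ b) (hv : 0 < v) :
    shrinkageWeight y b v ≤ 1 :=
  mul_le_one₀ (pow_le_one₀ (by positivity) ((div_le_one (by positivity)).2 (by linarith)))
    (by positivity) (Real.rpow_le_one_of_one_le_of_nonpos (by linarith) (by linarith))

theorem rpow_mul_shrinkageWeight {y : ℕ} {a b u : ℝ} (hu : 0 < u) :
    u ^ (-a - 1) * shrinkageWeight y b u = u ^ (y - a - 1) * (1 + u) ^ (-(y + b)) := by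
  rw [shrinkageWeight, div_pow, show (y : ℝ) - a - 1 = (-a - 1) + y by ring,
    show -((y : ℝ) + b) = -b - y by ring, Real.rpow_add_natCast hu.ne',
    Real.rpow_sub_natCast (by positivity)]
  ring

theorem integrableOn_rpow_mul_shrinkageWeight {y : ℕ} {a b : ℝ} (ha : 0 < a) (hb : 0 ≤ b)
    (hy : a < y) : IntegrableOn (fun u => u ^ (-a - 1) * shrinkageWeight y b u) (Ioi 0) := by
  have hm : Measurable fun u => u ^ (-a - 1) * shrinkageWeight y b u :=
    (by fun_prop : Measurable fun u : ℝ => u ^ (-a - 1)).mul (measurable_shrinkageWeight y b)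
  rw [← Ioc_union_Ioi_eq_Ioi zero_le_one]
  refine IntegrableOn.union ?_ ?_
  · have h1 : IntegrableOn (fun u : ℝ => u ^ (y - a - 1)) (Ioc 0 1) := by
      rw [← intervalIntegrable_iff_integrableOn_Ioc_of_le zero_le_one]
      exact intervalIntegral.intervalIntegrable_rpow' (by linarith)
    refine Integrable.mono' h1 hm.aestronglyMeasurable ?_
    refine (ae_restrict_iff' measurableSet_Ioc).2 (ae_of_all _ fun u hu => ?_)
    have hu0 : 0 < u := hu.1
    rw [rpow_mul_shrinkageWeight hu0, Real.norm_of_nonneg (by positivity)]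
    exact mul_le_of_le_one_right (by positivity)
      (Real.rpow_le_one_of_one_le_of_nonpos (by linarith)
        (neg_nonpos.2 (by positivity)))
  · have h1 : IntegrableOn (fun u : ℝ => u ^ (-a - 1)) (Ioi 1) :=
      integrableOn_Ioi_rpow_of_lt (by linarith) one_pos
    refine Integrable.mono' h1 hm.aestronglyMeasurable ?_
    refine (ae_restrict_iff' measurableSet_Ioi).2 (ae_of_all _ fun u (hu : 1 < u) => ?_)
    have hu0 : 0 < u := by linarith
    have := shrinkageWeight_pos (y := y) (b := b) hu0
    rw [Real.norm_of_nonneg (by positivity)]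
    exact mul_le_of_le_one_right (by positivity) (shrinkageWeight_le_one hb hu0)

/-- The recursion `B(y - a, a + b + 1) = (a + b) / (y + b) * B(y - a, a + b)` for the Beta integral,
from integrating the derivative of `u ^ (y - a) * (1 + u) ^ (-(y + b))` over `(0, ∞)`. -/
theorem integral_rpow_mul_shrinkageWeight_add_one {y : ℕ} {a b : ℝ} (ha : 0 < a) (hb : 0 ≤ b)
    (hy : a < y) :
    (y + b) * ∫ u in Ioi (0 : ℝ), u ^ (-a - 1) * shrinkageWeight y (b + 1) u =
      (a + b) * ∫ u in Ioi (0 : ℝ), u ^ (-a - 1) * shrinkageWeight y b u := by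
  have i1 := (integrableOn_rpow_mul_shrinkageWeight ha (b := b + 1) (by linarith) hy).const_mul
    ((y : ℝ) + b)
  have i0 := (integrableOn_rpow_mul_shrinkageWeight ha hb hy).const_mul (a + b)
  have hd : ∀ u ∈ Ioi (0 : ℝ), HasDerivAt (fun u : ℝ => u ^ (y - a) * (1 + u) ^ (-(y + b)))
      ((y + b) * (u ^ (-a - 1) * shrinkageWeight y (b + 1) u) -
        (a + b) * (u ^ (-a - 1) * shrinkageWeight y b u)) u := by
    intro u (hu : 0 < u)
    have hu1 : 0 < 1 + u := by linarith
    have d1 := Real.hasDerivAt_rpow_const (x := u) (p := y - a) (Or.inl hu.ne')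
    have d2 := ((hasDerivAt_id u).const_add 1).rpow_const (p := -(y + b)) (Or.inl hu1.ne')
    convert! d1.mul d2 using 1
    rw [rpow_mul_shrinkageWeight hu, rpow_mul_shrinkageWeight hu]
    simp only [id]
    rw [show -((y : ℝ) + (b + 1)) = -(y + b) - 1 by ring, Real.rpow_sub_one hu.ne',
      Real.rpow_sub_one hu1.ne']
    field_simp
    ring
  have hc : ContinuousWithinAt (fun u : ℝ => u ^ (y - a) * (1 + u) ^ (-(y + b))) (Ici 0) 0 := by
    refine ContinuousAt.continuousWithinAt (ContinuousAt.mul ?_ ?_)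
    · exact Real.continuousAt_rpow_const _ _ (Or.inr (by linarith))
    · exact (continuousAt_const.add continuousAt_id).rpow_const (Or.inl (by norm_num))
  have hlim : Tendsto (fun u : ℝ => u ^ (y - a) * (1 + u) ^ (-(y + b))) atTop (𝓝 0) := by
    have h0 : Tendsto (fun u : ℝ => (1 + u) ^ (-(a + b))) atTop (𝓝 0) :=
      (tendsto_rpow_neg_atTop (by positivity)).comp (tendsto_atTop_add_const_left _ 1 tendsto_id)
    refine squeeze_zero' ?_ ?_ h0
    · filter_upwards [eventually_gt_atTop 0] with u hu
      positivity
    · filter_upwards [eventually_gt_atTop 0] with u hu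
      rw [show -(a + b) = (y - a) + -(y + b) by ring, Real.rpow_add (by positivity)]
      gcongr
      linarith
  have h := integral_Ioi_of_hasDerivAt_of_tendsto hc hd (i1.sub i0) hlim
  rw [Real.zero_rpow (by linarith), zero_mul, sub_zero, integral_sub i1 i0, integral_const_mul,
    integral_const_mul] at h
  linarith

theorem integral_rpow_mul_shrinkageWeight_pos {y : ℕ} {a b : ℝ} (ha : 0 < a) (hb : 0 ≤ b)
    (hy : a < y) : 0 < ∫ u in Ioi (0 : ℝ), u ^ (-a - 1) * shrinkageWeight y b u := by
  have hpos : ∀ u : ℝ, 0 < u → 0 < u ^ (-a - 1) * shrinkageWeight y b u := fun u hu =>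
    mul_pos (Real.rpow_pos_of_pos hu _) (shrinkageWeight_pos hu)
  rw [setIntegral_pos_iff_support_of_nonneg_ae
    ((ae_restrict_iff' measurableSet_Ioi).2 (ae_of_all _ fun u hu => (hpos u hu).le))
    (integrableOn_rpow_mul_shrinkageWeight ha hb hy)]
  have : Ioi (0 : ℝ) ⊆ Function.support fun u => u ^ (-a - 1) * shrinkageWeight y b u :=
    fun u hu => (hpos u hu).ne'
  rw [inter_eq_right.2 this]
  simp

/-- The substitution `u = λ² s`. -/
theorem integral_localPrior_comp_mul {a K s : ℝ} {L : ℝ → ℝ} (hL : IsLocalPrior a K L)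
    (hs : 0 < s) (f : ℝ → ℝ) :
    ∫ t, f (t * s) ∂(localPrior a K L) =
      K * s ^ a * ∫ u in Ioi (0 : ℝ), u ^ (-a - 1) * L (u / s) * f u := by
  rw [integral_localPrior hL]
  have h := integral_comp_mul_left_Ioi (fun u => u ^ (-a - 1) * L (u / s) * f u) 0 hs
  rw [mul_zero, smul_eq_mul] at h
  rw [show K * s ^ a = K * s ^ (a + 1) * s⁻¹ by
    rw [Real.rpow_add_one hs.ne']; field_simp, mul_assoc, ← h, ← integral_const_mul]
  refine setIntegral_congr_fun measurableSet_Ioi fun t (ht : 0 < t) => ?_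
  rw [Real.mul_rpow hs.le ht.le, mul_div_cancel_left₀ _ hs.ne', mul_comm t s,
    show -a - 1 = -(a + 1) by ring, Real.rpow_neg hs.le]
  have : s ^ (a + 1) ≠ 0 := (Real.rpow_pos_of_pos hs _).ne'
  field_simp

theorem tendsto_integral_slowly_mul_shrinkageWeight {a K b M ℓ : ℝ} {L : ℝ → ℝ} {y : ℕ}
    {s : ℕ → ℝ} (hL : IsLocalPrior a K L) (ha : 0 < a) (hb : 0 ≤ b) (hy : a < y)
    (hM : ∀ t, 0 < t → L t ≤ M) (hℓ : Tendsto L atTop (𝓝 ℓ)) (hs : ∀ n, 0 < s n)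
    (hs_lim : Tendsto s atTop (𝓝 0)) :
    Tendsto (fun n => ∫ u in Ioi (0 : ℝ), u ^ (-a - 1) * L (u / s n) * shrinkageWeight y b u) atTop
      (𝓝 (ℓ * ∫ u in Ioi (0 : ℝ), u ^ (-a - 1) * shrinkageWeight y b u)) := by
  rw [← integral_const_mul]
  refine tendsto_integral_of_dominated_convergence
    (fun u => M * (u ^ (-a - 1) * shrinkageWeight y b u)) (fun n => ?_)
    ((integrableOn_rpow_mul_shrinkageWeight ha hb hy).const_mul M) (fun n => ?_) ?_
  · have h1 : AEMeasurable (fun u => L (u / s n)) (volume.restrict (Ioi (0 : ℝ))) := by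
      refine (aemeasurable_restrict_iff_comap_subtype measurableSet_Ioi).2
        (Measurable.aemeasurable ?_)
      exact hL.measurable.comp (g := fun t : Ioi (0 : ℝ) => L t)
        (f := fun u : Ioi (0 : ℝ) => ⟨u / s n, div_pos u.2 (hs n)⟩) (by fun_prop)
    exact (((by fun_prop : Measurable fun u : ℝ => u ^ (-a - 1)).aemeasurable.mul h1).mul
      (measurable_shrinkageWeight y b).aemeasurable).aestronglyMeasurable
  · refine (ae_restrict_iff' measurableSet_Ioi).2 (ae_of_all _ fun u (hu : 0 < u) => ?_)
    have h1 := hL.pos _ (div_pos hu (hs n))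
    have h2 := hM _ (div_pos hu (hs n))
    have h3 := shrinkageWeight_pos (y := y) (b := b) hu
    have h4 := Real.rpow_pos_of_pos hu (-a - 1)
    rw [Real.norm_of_nonneg (by positivity), mul_comm (u ^ (-a - 1)), mul_assoc]
    gcongr
  · refine (ae_restrict_iff' measurableSet_Ioi).2 (ae_of_all _ fun u (hu : 0 < u) => ?_)
    have h0 : Tendsto s atTop (𝓝[>] 0) :=
      tendsto_nhdsWithin_iff.2 ⟨hs_lim, Eventually.of_forall hs⟩
    have h1 : Tendsto (fun n => u / s n) atTop atTop := by
      simp only [div_eq_mul_inv]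
      exact (tendsto_inv_nhdsGT_zero.comp h0).const_mul_atTop hu
    have h2 := ((hℓ.comp h1).const_mul (u ^ (-a - 1))).mul_const (shrinkageWeight y b u)
    rw [mul_comm (u ^ (-a - 1)) ℓ, mul_assoc] at h2
    exact h2

/-- For `y > a` the rescaled posterior of `τ² λ²` converges to a Beta prime law, whose mean of `κ`
is `(a + α) / (y + α)`. -/
theorem tendsto_posteriorMeanKappa {α a K : ℝ} {L : ℝ → ℝ} {τ : ℕ → ℝ} (hα : 0 < α) (ha : 0 < a)
    (hL : IsLocalPrior a K L) (hA1 : ConditionA1 L) (hA2 : ConditionA2 L) (hτ : ∀ n, 0 < τ n)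
    (hτ_lim : Tendsto τ atTop (𝓝 0)) {y : ℕ} (hy : a < y) :
    Tendsto (fun n => posteriorMeanKappa α a K L (τ n) y) atTop (𝓝 ((a + α) / (y + α))) := by
  obtain ⟨-, ℓ, hℓ0, hℓ⟩ := hA1
  obtain ⟨M, -, hM⟩ := hA2
  have hs : ∀ n, 0 < τ n ^ 2 := fun n => pow_pos (hτ n) 2
  have hs_lim : Tendsto (fun n => τ n ^ 2) atTop (𝓝 0) := by simpa using hτ_lim.pow 2
  have hJ := integral_rpow_mul_shrinkageWeight_pos ha hα.le hy
  have hrec := integral_rpow_mul_shrinkageWeight_add_one ha hα.le hy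
  have h := (tendsto_integral_slowly_mul_shrinkageWeight (b := α + 1) hL ha (by linarith) hy hM hℓ
    hs hs_lim).div (tendsto_integral_slowly_mul_shrinkageWeight hL ha hα.le hy hM hℓ hs hs_lim)
    (mul_pos hℓ0 hJ).ne'
  rw [mul_div_mul_left _ _ hℓ0.ne', (div_eq_div_iff hJ.ne' (by positivity)).2
    ((mul_comm _ _).trans hrec)] at h
  refine h.congr fun n => ?_
  have hK : K * (τ n ^ 2) ^ a ≠ 0 := (mul_pos hL.const_pos (Real.rpow_pos_of_pos (hs n) a)).ne'
  simp only [Pi.div_apply]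
  rw [posteriorMeanKappa_eq hα (hτ n), integral_localPrior_comp_mul hL (hs n),
    integral_localPrior_comp_mul hL (hs n), mul_div_mul_left _ _ hK]

theorem tendsto_integral_shrinkageWeight_zero {a K b : ℝ} {L : ℝ → ℝ} {τ : ℕ → ℝ} (hb : 0 ≤ b)
    (hL : IsLocalPrior a K L) (hτ : ∀ n, 0 < τ n) (hτ_lim : Tendsto τ atTop (𝓝 0)) :
    Tendsto (fun n => ∫ t, shrinkageWeight 0 b (t * τ n ^ 2) ∂(localPrior a K L)) atTop (𝓝 1) := by
  have := isProbabilityMeasure_localPrior hL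
  have h1 : ∫ _, (1 : ℝ) ∂(localPrior a K L) = 1 := by simp
  rw [← h1]
  refine tendsto_integral_of_dominated_convergence (fun _ => 1) (fun n => ?_)
    (integrable_const _) (fun n => ?_) ?_
  · exact ((measurable_shrinkageWeight 0 b).comp (by fun_prop)).aestronglyMeasurable
  · filter_upwards [ae_localPrior_pos a K L] with t ht
    have hv : 0 < t * τ n ^ 2 := mul_pos ht (pow_pos (hτ n) 2)
    rw [Real.norm_of_nonneg (shrinkageWeight_pos hv).le]
    exact shrinkageWeight_le_one hb hv
  · refine ae_of_all _ fun t => ?_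
    have h := ((((hτ_lim.pow 2).const_mul t).const_add 1).rpow_const (p := -b)
      (Or.inl (by norm_num)))
    simpa [shrinkageWeight] using h

/-- At the count `0` the likelihood tends to `1`, so that the posterior of `λ²` tends to the prior
and `κ` to `1`. -/
theorem tendsto_posteriorMeanKappa_zero {α a K : ℝ} {L : ℝ → ℝ} {τ : ℕ → ℝ} (hα : 0 < α)
    (hL : IsLocalPrior a K L) (hτ : ∀ n, 0 < τ n) (hτ_lim : Tendsto τ atTop (𝓝 0)) :
    Tendsto (fun n => posteriorMeanKappa α a K L (τ n) 0) atTop (𝓝 1) := by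
  have h := (tendsto_integral_shrinkageWeight_zero (b := α + 1) (by linarith) hL hτ hτ_lim).div
    (tendsto_integral_shrinkageWeight_zero hα.le hL hτ hτ_lim) one_ne_zero
  rw [div_one] at h
  exact h.congr fun n => (posteriorMeanKappa_eq hα (hτ n) 0).symm

/-! ### Comparison of the two risks -/

/-- Dominated convergence for negative binomial probabilities of a sequence of sets that converges
pointwise. -/
theorem tendsto_negBinomial_real {α s₀ : ℝ} {s : ℕ → ℝ} {S : ℕ → Set ℕ} {S₀ : Set ℕ} (hα : 0 < α)
    (hs : ∀ n, 0 < s n) (hs₀ : 0 < s₀) (hlim : Tendsto s atTop (𝓝 s₀))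
    (hS : ∀ y, ∀ᶠ n in atTop, y ∈ S n ↔ y ∈ S₀) :
    Tendsto (fun n => (negBinomial α (1 / (1 + s n))).real (S n)) atTop
      (𝓝 ((negBinomial α (1 / (1 + s₀))).real S₀)) := by
  have hΓ : 0 < Real.Gamma α := Real.Gamma_pos_of_pos hα
  have key : ∀ {t : ℝ} (_ : 0 < t) (T : Set ℕ), (negBinomial α (1 / (1 + t))).real T =
      ∑' y, T.indicator (fun y => (negBinomial α (1 / (1 + t))).real {y}) y := by
    intro t ht T
    have := isProbabilityMeasure_negBinomial hα ht
    rw [← integral_indicator_one (MeasurableSet.of_discrete), integral_countable]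
    · refine tsum_congr fun y => ?_
      by_cases h : y ∈ T <;> simp [h]
    · exact (integrable_const (1 : ℝ)).indicator MeasurableSet.of_discrete
  have mass : ∀ {t : ℝ} (_ : 0 < t) (y : ℕ), (negBinomial α (1 / (1 + t))).real {y} =
      Real.Gamma (y + α) / (Real.Gamma α * y.factorial) * (1 - 1 / (1 + t)) ^ y *
        (1 / (1 + t)) ^ α := fun ht y =>
    negBinomial_real_singleton hα (by positivity) ((div_le_one (by positivity)).2 (by linarith)) y
  have hs1 : 0 < s₀ + 1 := by positivity
  have hsum : Summable fun y : ℕ => (negBinomial α (1 / (1 + (s₀ + 1)))).real {y} := by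
    have := isProbabilityMeasure_negBinomial hα hs1
    exact summable_measure_toReal (fun y => MeasurableSet.singleton y)
      fun i j hij => by simpa using hij
  rw [key hs₀]
  simp only [fun n => key (hs n) (S n)]
  -- The masses increase with the mean up to the factor `(1 + s) ^ (-α)`, so those at `s₀ + 1`
  -- give a summable bound.
  refine tendsto_tsum_of_dominated_convergence (hsum.mul_left ((1 + (s₀ + 1)) ^ α)) (fun y => ?_) ?_
  · have hq : Tendsto (fun n => 1 / (1 + s n)) atTop (𝓝 (1 / (1 + s₀))) :=
      tendsto_const_nhds.div (hlim.const_add 1) (by positivity)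
    have h : Tendsto (fun n => (negBinomial α (1 / (1 + s n))).real {y}) atTop
        (𝓝 ((negBinomial α (1 / (1 + s₀))).real {y})) := by
      rw [mass hs₀]
      simp only [fun n => mass (hs n) y]
      exact (((hq.const_sub 1).pow y).const_mul _).mul (hq.rpow_const (Or.inr hα.le))
    by_cases hy : y ∈ S₀
    · rw [indicator_of_mem hy]
      refine h.congr' ?_
      filter_upwards [hS y] with n hn
      rw [indicator_of_mem (hn.2 hy)]
    · rw [indicator_of_notMem hy]
      refine tendsto_const_nhds.congr' ?_
      filter_upwards [hS y] with n hn
      rw [indicator_of_notMem (mt hn.1 hy)]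
  · filter_upwards [hlim.eventually_le_const (lt_add_one s₀)] with n hn y
    refine (norm_indicator_le_norm_self _ _).trans ?_
    have := hs n
    have hG : 0 < Real.Gamma (y + α) := Real.Gamma_pos_of_pos (by positivity)
    have hq : 1 / (1 + (s₀ + 1)) ≤ 1 / (1 + s n) := by gcongr
    have hq1 : 1 / (1 + s n) ≤ 1 := (div_le_one (by positivity)).2 (by linarith)
    have hq2 : 0 ≤ 1 - 1 / (1 + s n) := by linarith
    have hq3 : 0 ≤ 1 - 1 / (1 + (s₀ + 1)) := by linarith
    have hC : (1 + (s₀ + 1)) ^ α * (1 / (1 + (s₀ + 1))) ^ α = 1 := by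
      rw [← Real.mul_rpow (by positivity) (by positivity), mul_one_div_cancel (by positivity),
        Real.one_rpow]
    rw [Real.norm_of_nonneg measureReal_nonneg, mass (hs n), mass hs1, mul_left_comm, hC]
    gcongr
    exact Real.rpow_le_one (by positivity) hq1 hα.le

/-- The limit `(y - a) / (y + α)` of the posterior mean of `1 - κ` exceeds `δ / (2 (δ + 1))` exactly
above the cutoff of the risk bound. -/
theorem cutoff_lt_iff {α δ a y : ℝ} (hδ : 0 < δ) (hy : 0 < y + α) :
    2 * a + α - 2 * (a + α) / (δ + 2) < y ↔ δ / (2 * (δ + 1)) < 1 - (a + α) / (y + α) := by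
  have e1 : 2 * a + α - 2 * (a + α) / (δ + 2) = (2 * a * (δ + 1) + α * δ) / (δ + 2) := by
    field_simp; ring
  have e2 : 1 - (a + α) / (y + α) = (y - a) / (y + α) := by field_simp; ring
  rw [e1, e2, div_lt_iff₀ (by positivity), div_lt_div_iff₀ (by positivity) hy]
  constructor <;> intro h <;> linarith

theorem oneGroupRisk_eq {n : ℕ} {p α β δ a K τ : ℝ} {L : ℝ → ℝ} (h0 : 0 ≤ p) (h1 : p ≤ 1)
    (hα : 0 < α) (hβ : 0 < β) (hδ : 0 < δ) :
    oneGroupRisk n p α β δ a K L τ = n * ((1 - p) * (negBinomial α (1 / (1 + β))).real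
        {y | δ / (2 * (δ + 1)) < 1 - posteriorMeanKappa α a K L τ y} +
      p * (negBinomial α (1 / (1 + (β + δ)))).real
        {y | ¬ δ / (2 * (δ + 1)) < 1 - posteriorMeanKappa α a K L τ y}) :=
  bayesRisk_coordinatewise h0 h1 hα hβ hδ
    fun y => δ / (2 * (δ + 1)) < 1 - posteriorMeanKappa α a K L τ y

/-- A rule that accepts at the count `0` misses every false null hypothesis with count `0`, and its
false positives are confined to nonzero counts. -/
theorem oneGroupRisk_div_bounds {n : ℕ} {p α β δ a K τ : ℝ} {L : ℝ → ℝ} (hn : 0 < n) (h0 : 0 < p)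
    (h1 : p < 1) (hα : 0 < α) (hβ : 0 < β) (hδ : 0 < δ)
    (hacc : ¬ δ / (2 * (δ + 1)) < 1 - posteriorMeanKappa α a K L τ 0) :
    (1 + (β + δ)) ^ (-α) ≤ oneGroupRisk n p α β δ a K L τ / (n * p) ∧
    oneGroupRisk n p α β δ a K L τ / (n * p) ≤ α * (β / p) +
      (negBinomial α (1 / (1 + (β + δ)))).real
        {y | ¬ δ / (2 * (δ + 1)) < 1 - posteriorMeanKappa α a K L τ y} := by
  have := isProbabilityMeasure_negBinomial hα hβ
  have := isProbabilityMeasure_negBinomial hα (add_pos hβ hδ)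
  have hn' : (0 : ℝ) < n := by exact_mod_cast hn
  have h1p : 0 < 1 - p := by linarith
  rw [oneGroupRisk_eq h0.le h1.le hα hβ hδ, mul_div_mul_left _ _ hn'.ne', add_div,
    mul_div_cancel_left₀ _ h0.ne', ← negBinomial_real_singleton_zero hα (add_pos hβ hδ)]
  constructor
  · refine le_add_of_nonneg_of_le (by positivity) (measureReal_mono ?_)
    rintro y rfl
    exact hacc
  · refine add_le_add_left ?_ _
    rw [← mul_div_assoc]
    refine div_le_div_of_nonneg_right ?_ h0.le
    have h1p' : 1 - p ≤ 1 := by linarith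
    refine (mul_le_of_le_one_left measureReal_nonneg h1p').trans
      ((measureReal_mono ?_).trans (negBinomial_real_ne_zero_le hα hβ))
    rintro y hy rfl
    exact hacc hy

theorem mainTheorem1
    (α δ a K C₁ c : ℝ) (L : ℝ → ℝ) (p β τ : ℕ → ℝ)
    (hα : 0 < α) (hδ : 0 < δ)
    (hp : ∀ n, 0 < p n ∧ p n < 1) (hp_lim : Tendsto p atTop (𝓝 0))
    (hβ : ∀ n, 0 < β n) (hC₁ : 1 < C₁) (hc : 0 < c)
    (hβ_lim : Tendsto (fun n => β n / p n ^ C₁) atTop (𝓝 c))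
    (ha : 1 < a) (hL : IsLocalPrior a K L) (hA1 : ConditionA1 L) (hA2 : ConditionA2 L)
    (hτ : ∀ n, 0 < τ n) (hτ_lim : Tendsto τ atTop (𝓝 0)) :
    let ratio : ℕ → EReal := fun n =>
      ((oneGroupRisk n (p n) α (β n) δ a K L (τ n) / oracleRisk n (p n) α (β n) δ : ℝ) : EReal)
    1 ≤ liminf ratio atTop ∧
    liminf ratio atTop ≤ limsup ratio atTop ∧
    limsup ratio atTop ≤
      (((δ + 1) ^ α * (negBinomial α (1 / (δ + 1))).real
        {y : ℕ | (y : ℝ) ≤ 2 * a + α - 2 * (a + α) / (δ + 2)} : ℝ) : EReal) ∧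
    Tendsto (fun n : ℕ => oracleRisk n (p n) α (β n) δ / (n * p n * (δ + 1) ^ (-α)))
      atTop (𝓝 1) := by
  intro ratio
  have ha0 : 0 < a := one_pos.trans ha
  have hβp := tendsto_div_of_tendsto_div_rpow (fun n => (hp n).1) hp_lim hC₁ hβ_lim
  have hβ0 : Tendsto β atTop (𝓝 0) := by
    have h := hβp.mul hp_lim
    rw [mul_zero] at h
    exact h.congr fun n => div_mul_cancel₀ _ (hp n).1.ne'
  have hB : 0 < (δ + 1) ^ (-α) := by positivity
  have hBO := tendsto_oracleRisk_div hα hδ hp hp_lim hβ hβ0 hβp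
  have hsδ : Tendsto (fun n => β n + δ) atTop (𝓝 δ) := by simpa using hβ0.add_const δ
  have hδ0 : 0 < δ / (2 * (δ + 1)) := by positivity
  have hacc : ∀ᶠ n in atTop, ¬ δ / (2 * (δ + 1)) < 1 - posteriorMeanKappa α a K L (τ n) 0 := by
    have h := (tendsto_posteriorMeanKappa_zero hα hL hτ hτ_lim).const_sub 1
    rw [sub_self] at h
    filter_upwards [h.eventually_lt_const hδ0] with n hn using hn.le.not_gt
  have hrej : ∀ y : ℕ, 2 * a + α - 2 * (a + α) / (δ + 2) < y →
      ∀ᶠ n in atTop, δ / (2 * (δ + 1)) < 1 - posteriorMeanKappa α a K L (τ n) y := by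
    intro y hy
    have hyα : 0 < (y : ℝ) + α := by positivity
    have hlt := (cutoff_lt_iff hδ hyα).1 hy
    have hya : a < y := by
      have : (a + α) / (y + α) < 1 := by linarith
      rw [div_lt_one hyα] at this
      linarith
    exact ((tendsto_posteriorMeanKappa hα ha0 hL hA1 hA2 hτ hτ_lim hya).const_sub
      1).eventually_const_lt hlt
  -- The acceptance set need not converge at counts up to the cutoff, so it is enlarged there.
  have hH := tendsto_negBinomial_real hα (fun n => add_pos (hβ n) hδ) hδ hsδ
    (S := fun n => {y : ℕ | (y : ℝ) ≤ 2 * a + α - 2 * (a + α) / (δ + 2)} ∪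
      {y | ¬ δ / (2 * (δ + 1)) < 1 - posteriorMeanKappa α a K L (τ n) y})
    (S₀ := {y : ℕ | (y : ℝ) ≤ 2 * a + α - 2 * (a + α) / (δ + 2)}) (by
      intro y
      rcases le_or_gt (y : ℝ) (2 * a + α - 2 * (a + α) / (δ + 2)) with h | h
      · exact Eventually.of_forall fun n => by simp [h]
      · filter_upwards [hrej y h] with n hn
        simp only [mem_union, mem_ofPred_eq, hn, not_true_eq_false, or_false])
  have hratio : ∀ᶠ n : ℕ in atTop, 0 < oracleRisk n (p n) α (β n) δ / (n * p n) ∧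
      ratio n = ((oneGroupRisk n (p n) α (β n) δ a K L (τ n) / (n * p n) /
        (oracleRisk n (p n) α (β n) δ / (n * p n)) : ℝ) : EReal) := by
    filter_upwards [hBO.eventually_const_lt hB, eventually_gt_atTop 0] with n hn hn0
    have h1 : (n : ℝ) * p n ≠ 0 := mul_ne_zero (by exact_mod_cast hn0.ne') (hp n).1.ne'
    exact ⟨hn, by rw [div_div_div_cancel_right₀ h1]⟩
  refine ⟨?_, liminf_le_limsup, ?_, ?_⟩
  · have hl : Tendsto (fun n => (((1 + (β n + δ)) ^ (-α) /
        (oracleRisk n (p n) α (β n) δ / (n * p n)) : ℝ) : EReal)) atTop (𝓝 ((1 : ℝ) : EReal)) := by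
      have hb := (hsδ.const_add 1).rpow_const (p := -α) (Or.inl (by positivity))
      rw [add_comm 1 δ] at hb
      have h := hb.div hBO hB.ne'
      rw [div_self hB.ne'] at h
      exact (continuous_coe_real_ereal.tendsto _).comp h
    rw [← EReal.coe_one, ← hl.liminf_eq]
    refine liminf_le_liminf ?_
    filter_upwards [hratio, hacc, eventually_gt_atTop 0] with n hn hn1 hn0
    rw [hn.2, EReal.coe_le_coe_iff]
    exact div_le_div_of_nonneg_right
      (oneGroupRisk_div_bounds hn0 (hp n).1 (hp n).2 hα (hβ n) hδ hn1).1 hn.1.le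
  · have hu := ((hβp.const_mul α).add hH).div hBO hB.ne'
    rw [mul_zero, zero_add, Real.rpow_neg (by positivity), div_inv_eq_mul, mul_comm _ ((δ + 1) ^ α),
      add_comm 1 δ] at hu
    have hu' := (continuous_coe_real_ereal.tendsto _).comp hu
    rw [← hu'.limsup_eq]
    refine limsup_le_limsup ?_
    filter_upwards [hratio, hacc, eventually_gt_atTop 0] with n hn hn1 hn0
    have := isProbabilityMeasure_negBinomial hα (add_pos (hβ n) hδ)
    rw [hn.2]
    refine EReal.coe_le_coe_iff.2 (div_le_div_of_nonneg_right
      ((oneGroupRisk_div_bounds hn0 (hp n).1 (hp n).2 hα (hβ n) hδ hn1).2.trans ?_) hn.1.le)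
    exact add_le_add le_rfl (measureReal_mono subset_union_right)
  · have h := hBO.div_const ((δ + 1) ^ (-α))
    rw [div_self hB.ne'] at h
    exact h.congr fun n => div_div _ _ _
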